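/- For a real matrix $A\in\mathbb{R}^{n\times n}$ with singular values $\sigma_1\ge\dots\ge\sigma_n\ge 0$ let $\|A\|_{S_p}=\big(\sum_i\sigma_i^p\big)^{1/p}$ for $0<p<\infty$, $\|A\|_{S_\infty}=\sigma_1$, and $\|A\|_{S_0}=\operatorname{rank}(A)$. For $0\le p\le\infty$ and $\epsilon>0$, a matrix $A'\in\mathbb{R}^{n\times n}$ is an $(\epsilon,S_p)$-norm approximation of $A$ if $\|A-A'\|_{S_p}\le\epsilon\|A\|_{S_p}$; it is an $(\epsilon,S_p,s)$-norm sparsifier of $A$ if, in addition, it has at most $s$ non-zero entries. Write $\log$ for the logarithm to base $2$. Fix $2\le q\le\infty$ and $0\le p<1$, and let $\epsilon_0=0.1$. There are constants $c>0$ and $k\in\mathbb{N}$, depending only on $p$ and $q$, such that the following holds. For all integers $n\ge 2$ and all real $\epsilon$ with $\frac{1}{\log n}<\epsilon$ and, if $p>0$, also $\epsilon<(2^p-1)^{1/p}$, there is a matrix $A\in\mathbb{R}^{n\times n}$ that has an $(\epsilon,S_p,n)$-norm sparsifier, but every $(\epsilon_0,S_q)$-norm approximation of $A$ has at least $c\,n^2/(\log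 n)^k$ non-zero entries (that is, $\tilde\Omega(n^2)$ non-zero entries). -/

import Mathlib

open scoped NNReal ENNReal

namespace SchattenSparse

/-- The number of non-zero entries of a real matrix. -/
noncomputable def nnz {n d : ℕ} (A : Matrix (Fin n) (Fin d) ℝ) : ℕ :=
  (Finset.univ.filter fun ij : Fin n × Fin d => A ij.1 ij.2 ≠ 0).card

/-- The `i`-th largest singular value of a real matrix (counted from `i = 0`, with multiplicity):
the square root of the `i`-th largest eigenvalue of `Aᵀ A`. -/
noncomputable def singularValue {n d : ℕ} (A : Matrix (Fin n) (Fin d) ℝ) (i : ℕ) : ℝ :=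
  (Matrix.toEuclideanLin A).singularValues i

/-- The Schatten `p`-norm for `0 ≤ p ≤ ∞`: the rank for `p = 0`, the largest singular value for
`p = ∞`, and otherwise the `ℓ_p` (quasi-)norm of the vector of singular values. -/
noncomputable def schattenNorm {n d : ℕ} (p : ℝ≥0∞) (A : Matrix (Fin n) (Fin d) ℝ) : ℝ :=
  if p = 0 then (A.rank : ℝ)
  else if p = ∞ then singularValue A 0
  else (∑ i : Fin d, singularValue A i ^ p.toReal) ^ (1 / p.toReal)

/-- `A'` is an `(ε, S_p)`-norm approximation of `A`. -/
def IsNormApprox {n d : ℕ} (ε : ℝ) (p : ℝ≥0∞) (A A' : Matrix (Fin n) (Fin d) ℝ) : Prop :=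
  schattenNorm p (A - A') ≤ ε * schattenNorm p A

/-- `A'` is an `(ε, S_p, s)`-norm sparsifier of `A`. -/
def IsNormSparsifier {n d : ℕ} (ε : ℝ) (p : ℝ≥0∞) (s : ℕ) (A A' : Matrix (Fin n) (Fin d) ℝ) :
    Prop :=
  IsNormApprox ε p A A' ∧ nnz A' ≤ s

end SchattenSparse

/-!
With `L = log₂ n`, the matrix is block diagonal, with blocks `s • D` and the identity of size
`r = n - m`, where `D` is an `m × m` orthogonal matrix all of whose entries are `± 1 / √m`, the
size `m` is of order `n / L ^ 2`, and `s ^ 2 = n / m`. Its singular values are `s` (`m` times) and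
`1` (`r` times).

For `p < 1` the identity block carries almost all of the Schatten `p`-norm: since `s ≥ 1`, one has
`m * s ^ p ≤ m * s = √(n * m)`, which is at most `r / L`. Dropping the flat block is therefore an
approximation with relative error `1 / L`, and what remains is diagonal
(`isNormApprox_blockMatrix`).

For `q ≥ 2` the flat block already carries a constant fraction of the Schatten `q`-norm, because
`r ≤ m * s ^ 2 ≤ m * s ^ q` (`schattenNorm_blockMatrix_le`). The error `C = A - B` of an
approximation `B` may have rank `n`, but its Frobenius mass on the `m` columns of the flat block is
at most `m ^ (1 - 2 / q) * ‖C‖_q ^ 2` (`sum_sq_cols_le`): in a basis of right singular vectors that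
mass is a combination of the squared singular values of `C` with weights in `[0, 1]` of total `m`,
and the weighted power mean inequality applies. This is a small fraction of the Frobenius mass
`m * s ^ 2` of the flat block, which is spread evenly over its entries, so `B` vanishes at only few
of them (`le_nnz_of_isNormApprox`).
-/

namespace SchattenSparse

open Matrix

/-! ### Singular values and Schatten norms -/

/-- The matrix `C` is expanded in a basis of right singular vectors: the squared norm of the
`j`-th column of `C` is a combination of the squared singular values, with doubly stochastic
coefficients `(b i j) ^ 2`. -/
lemma exists_orthonormalBasis_sum_sq_col {n d : ℕ} (C : Matrix (Fin n) (Fin d) ℝ) :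
    ∃ b : OrthonormalBasis (Fin d) ℝ (EuclideanSpace ℝ (Fin d)),
      ∀ j, ∑ k, C k j ^ 2 = ∑ i : Fin d, (b i) j ^ 2 * singularValue C i ^ 2 := by
  set T := Matrix.toEuclideanLin C with hT
  have hd : Module.finrank ℝ (EuclideanSpace ℝ (Fin d)) = d := finrank_euclideanSpace_fin
  have hS := T.isSymmetric_adjoint_comp_self
  refine ⟨hS.eigenvectorBasis hd, fun j => ?_⟩
  set b := hS.eigenvectorBasis hd
  set x : EuclideanSpace ℝ (Fin d) := EuclideanSpace.single j 1
  have h1 : ∑ k, C k j ^ 2 = ‖T x‖ ^ 2 := by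
    rw [EuclideanSpace.norm_sq_eq]
    simp [hT, x, Matrix.toLpLin_apply]
  have h2 : ‖T x‖ ^ 2 = inner ℝ ((LinearMap.adjoint T ∘ₗ T) x) x := by
    rw [LinearMap.comp_apply, LinearMap.adjoint_inner_left, real_inner_self_eq_norm_sq]
  rw [h1, h2, ← b.sum_inner_mul_inner]
  refine Finset.sum_congr rfl fun i _ => ?_
  have h3 : inner ℝ ((LinearMap.adjoint T ∘ₗ T) x) (b i) = singularValue C i ^ 2 * (b i) j := by
    rw [hS x (b i), hS.apply_eigenvectorBasis hd i, singularValue, T.sq_singularValues_fin hd i]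
    simp [x, b, inner_smul_right, EuclideanSpace.inner_single_left]
  have h4 : inner ℝ (b i) x = (b i) j := by
    simp [x, EuclideanSpace.inner_single_right]
  rw [h3, h4]
  ring

lemma singularValue_nonneg {n d : ℕ} (C : Matrix (Fin n) (Fin d) ℝ) (i : ℕ) :
    0 ≤ singularValue C i :=
  LinearMap.singularValues_nonneg _ _

lemma schattenNorm_nonneg {n d : ℕ} (p : ℝ≥0∞) (C : Matrix (Fin n) (Fin d) ℝ) :
    0 ≤ schattenNorm p C := by
  unfold schattenNorm
  split_ifs
  · positivity
  · exact singularValue_nonneg _ _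
  · exact Real.rpow_nonneg
      (Finset.sum_nonneg fun i _ => Real.rpow_nonneg (singularValue_nonneg _ _) _) _

lemma schattenNorm_zero {n d : ℕ} (p : ℝ≥0∞) :
    schattenNorm p (0 : Matrix (Fin n) (Fin d) ℝ) = 0 := by
  unfold schattenNorm
  split_ifs with h0 h1
  · simp
  · simp [singularValue]
  · have hp : p.toReal ≠ 0 := (ENNReal.toReal_pos h0 h1).ne'
    simp [singularValue, Real.zero_rpow hp, Real.zero_rpow (inv_ne_zero hp)]

/-- The Frobenius mass of a set `S` of columns is controlled by the Schatten `q`-norm with the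
constant of an `#S`-dimensional space. For `q = ∞` the exponent reads `1 - 2 / 0 = 1`, which is
the correct value. -/
lemma sum_sq_cols_le {n d : ℕ} {q : ℝ≥0∞} (hq : 2 ≤ q) (C : Matrix (Fin n) (Fin d) ℝ)
    (S : Finset (Fin d)) :
    ∑ j ∈ S, ∑ k, C k j ^ 2 ≤ (S.card : ℝ) ^ (1 - 2 / q.toReal) * schattenNorm q C ^ 2 := by
  obtain ⟨b, hb⟩ := exists_orthonormalBasis_sum_sq_col C
  set w : Fin d → ℝ := fun i => ∑ j ∈ S, (b i) j ^ 2 with hw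
  have hw0 : ∀ i, 0 ≤ w i := fun i => Finset.sum_nonneg fun j _ => sq_nonneg _
  have hw1 : ∀ i, w i ≤ 1 := fun i => by
    have h : ‖b i‖ ^ 2 = 1 := by rw [b.norm_eq_one, one_pow]
    rw [EuclideanSpace.norm_sq_eq] at h
    rw [← h]
    simp only [Real.norm_eq_abs, sq_abs]
    exact Finset.sum_le_sum_of_subset_of_nonneg (Finset.subset_univ S) fun _ _ _ => sq_nonneg _
  have hwS : ∑ i, w i = S.card := by
    rw [hw, Finset.sum_comm, Finset.card_eq_sum_ones, Nat.cast_sum]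
    refine Finset.sum_congr rfl fun j _ => ?_
    have h := b.sum_sq_norm_inner_right (EuclideanSpace.single j (1 : ℝ))
    simpa [EuclideanSpace.inner_single_right] using h
  have hmass : ∑ j ∈ S, ∑ k, C k j ^ 2 = ∑ i : Fin d, w i * singularValue C i ^ 2 := by
    simp_rw [hb, hw, Finset.sum_mul]
    exact Finset.sum_comm
  have hq0 : q ≠ 0 := by rintro rfl; simp at hq
  rw [hmass]
  by_cases hqt : q = ∞
  · have hle : ∀ i : Fin d, singularValue C i ^ 2 ≤ schattenNorm q C ^ 2 := fun i => by
      rw [schattenNorm, if_neg hq0, if_pos hqt]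
      exact pow_le_pow_left₀ (singularValue_nonneg _ _)
        (LinearMap.singularValues_antitone _ (Nat.zero_le _)) 2
    calc ∑ i : Fin d, w i * singularValue C i ^ 2
        ≤ ∑ i : Fin d, w i * schattenNorm q C ^ 2 :=
          Finset.sum_le_sum fun i _ => mul_le_mul_of_nonneg_left (hle i) (hw0 i)
      _ = _ := by rw [← Finset.sum_mul, hwS, hqt]; simp
  · have hq2 : 2 ≤ q.toReal := by
      simpa using ENNReal.toReal_mono hqt hq
    have hqpos : 0 < q.toReal := by linarith
    have hpow : ∀ i : Fin d, (singularValue C i ^ 2) ^ (q.toReal / 2)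
        = singularValue C i ^ q.toReal := fun i => by
      rw [← Real.rpow_natCast_mul (singularValue_nonneg _ _)]
      congr 1
      push_cast
      ring
    refine (Real.inner_le_weight_mul_Lp_of_nonneg Finset.univ (p := q.toReal / 2) (by linarith)
      w _ hw0 fun i => sq_nonneg (singularValue C i)).trans ?_
    rw [hwS, inv_div, schattenNorm, if_neg hq0, if_neg hqt]
    simp_rw [hpow]
    refine mul_le_mul_of_nonneg_left ?_ (Real.rpow_nonneg (Nat.cast_nonneg _) _)
    have hs : ∀ i : Fin d, 0 ≤ singularValue C i ^ q.toReal := fun i =>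
      Real.rpow_nonneg (singularValue_nonneg _ _) _
    rw [← Real.rpow_mul_natCast (Finset.sum_nonneg fun i _ => hs i), Nat.cast_ofNat,
      one_div_mul_eq_div]
    refine Real.rpow_le_rpow (Finset.sum_nonneg fun i _ => mul_nonneg (hw0 i) (hs i)) ?_
      (by positivity)
    exact Finset.sum_le_sum fun i _ => mul_le_of_le_one_left (hs i) (hw1 i)

/-- If `Aᵀ A` is diagonal with entries `e i ^ 2`, `e i ≥ 0`, then the singular values of `A` are
the `e i`, up to order. -/
lemma map_singularValue_of_gram {n d : ℕ} {A : Matrix (Fin n) (Fin d) ℝ} {e : Fin d → ℝ}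
    (he : ∀ i, 0 ≤ e i) (hA : Aᵀ * A = diagonal fun i => e i ^ 2) :
    Multiset.map (fun i : Fin d => singularValue A i) Finset.univ.val =
      Multiset.map e Finset.univ.val := by
  set T := Matrix.toEuclideanLin A with hT
  have hd : Module.finrank ℝ (EuclideanSpace ℝ (Fin d)) = d := finrank_euclideanSpace_fin
  have hS := T.isSymmetric_adjoint_comp_self
  have hgram : LinearMap.adjoint T ∘ₗ T = Matrix.toEuclideanLin (diagonal fun i => e i ^ 2) := by
    rw [← hA, hT, ← Matrix.toEuclideanLin_conjTranspose_eq_adjoint,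
      Matrix.conjTranspose_eq_transpose_of_trivial]
    ext x i
    simp [Matrix.toLpLin_apply]
  have hchar : (LinearMap.adjoint T ∘ₗ T).charpoly = (diagonal fun i => e i ^ 2).charpoly := by
    rw [hgram, Matrix.toEuclideanLin, Matrix.toLpLin_eq_toLin, Matrix.charpoly_toLin]
  have hroots := hS.roots_charpoly_eq_eigenvalues hd
  rw [hchar, Matrix.charpoly_diagonal, Polynomial.roots_prod _ _
    (Finset.prod_ne_zero_iff.2 fun i _ => Polynomial.X_sub_C_ne_zero _)] at hroots
  simp only [Polynomial.roots_X_sub_C, Multiset.bind_singleton] at hroots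
  have h := congrArg (Multiset.map Real.sqrt) hroots
  rw [Multiset.map_map, Multiset.map_map] at h
  convert h.symm using 1
  · refine Multiset.map_congr rfl fun i _ => ?_
    simp [singularValue, T.singularValues_fin hd i, ← hT]
  · refine Multiset.map_congr rfl fun i _ => ?_
    simp [Real.sqrt_sq (he i)]

lemma schattenNorm_of_gram {n d : ℕ} {A : Matrix (Fin n) (Fin d) ℝ} {e : Fin d → ℝ}
    (he : ∀ i, 0 ≤ e i) (hA : Aᵀ * A = diagonal fun i => e i ^ 2) {p : ℝ≥0∞} (hp0 : p ≠ 0)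
    (hpt : p ≠ ∞) : schattenNorm p A = (∑ i, e i ^ p.toReal) ^ (1 / p.toReal) := by
  rw [schattenNorm, if_neg hp0, if_neg hpt]
  congr 1
  have h := congrArg (fun s => (Multiset.map (fun x : ℝ => x ^ p.toReal) s).sum)
    (map_singularValue_of_gram he hA)
  simp only [Multiset.map_map, Function.comp_def] at h
  exact h

lemma schattenNorm_top_le_of_gram {n d : ℕ} {A : Matrix (Fin n) (Fin d) ℝ} {e : Fin d → ℝ}
    (he : ∀ i, 0 ≤ e i) (hA : Aᵀ * A = diagonal fun i => e i ^ 2) {M : ℝ} (hM0 : 0 ≤ M)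
    (hM : ∀ i, e i ≤ M) : schattenNorm ∞ A ≤ M := by
  rw [schattenNorm, if_neg ENNReal.top_ne_zero, if_pos rfl]
  rcases Nat.eq_zero_or_pos d with rfl | hd
  · refine (le_of_eq ?_).trans hM0
    exact LinearMap.singularValues_of_finrank_le _ (by simp)
  · have h : singularValue A ((⟨0, hd⟩ : Fin d) : ℕ) ∈ Multiset.map e Finset.univ.val := by
      rw [← map_singularValue_of_gram he hA]
      exact Multiset.mem_map_of_mem (fun i : Fin d => singularValue A i) (Finset.mem_univ_val _)
    obtain ⟨j, -, hj⟩ := Multiset.mem_map.1 h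
    exact hj ▸ hM j

lemma schattenNorm_zero_exponent_of_gram {n d : ℕ} {A : Matrix (Fin n) (Fin d) ℝ} {e : Fin d → ℝ}
    (hA : Aᵀ * A = diagonal fun i => e i ^ 2) :
    schattenNorm 0 A = ∑ i, if e i = 0 then (0 : ℝ) else 1 := by
  rw [schattenNorm, if_pos rfl, ← Matrix.rank_transpose_mul_self, hA, Matrix.rank_diagonal,
    Fintype.card_subtype, Finset.card_eq_sum_ones, Finset.sum_filter]
  push_cast
  refine Finset.sum_congr rfl fun i _ => ?_
  by_cases h : e i = 0 <;> simp [h]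

/-! ### Flat orthogonal matrices -/

/-- Sylvester's construction, normalised to be orthogonal. -/
lemma exists_flat_orthogonal (k : ℕ) :
    ∃ D : Matrix (Fin (2 ^ k)) (Fin (2 ^ k)) ℝ,
      (∀ i j, D i j ^ 2 = 1 / (2 : ℝ) ^ k) ∧ Dᵀ * D = 1 := by
  induction k with
  | zero =>
    refine ⟨1, fun i j => ?_, by simp⟩
    obtain rfl : i = j := Subsingleton.elim (α := Fin 1) i j
    rw [one_apply_eq]
    norm_num
  | succ k ih =>
    obtain ⟨D, hD, hO⟩ := ih
    let f : Fin (2 ^ k) ⊕ Fin (2 ^ k) ≃ Fin (2 ^ (k + 1)) :=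
      finSumFinEquiv.trans (finCongr (by ring))
    have h2 : (√2 : ℝ)⁻¹ ^ 2 = 1 / 2 := by
      rw [inv_pow, Real.sq_sqrt (by norm_num)]
      norm_num
    refine ⟨Matrix.reindex f f ((√2 : ℝ)⁻¹ • fromBlocks D D D (-D)), fun i j => ?_, ?_⟩
    · obtain ⟨i, rfl⟩ := f.surjective i
      obtain ⟨j, rfl⟩ := f.surjective j
      have : (1 : ℝ) / 2 ^ (k + 1) = 1 / 2 * (1 / 2 ^ k) := by rw [pow_succ]; field_simp
      rw [this]
      rcases i with i | i <;> rcases j with j | j <;>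
        simp only [reindex_apply, submatrix_apply, Equiv.symm_apply_apply, Matrix.smul_apply,
          fromBlocks_apply₁₁, fromBlocks_apply₁₂, fromBlocks_apply₂₁, fromBlocks_apply₂₂,
          smul_eq_mul, mul_pow, h2, Matrix.neg_apply, neg_sq, hD]
    · rw [transpose_reindex, reindex_apply, reindex_apply, submatrix_mul_equiv, transpose_smul,
        smul_mul_smul_comm, ← sq, h2, fromBlocks_transpose, fromBlocks_multiply]
      simp only [transpose_neg, mul_neg, neg_mul, neg_neg, hO, add_neg_cancel]
      have : (1 / 2 : ℝ) • fromBlocks (1 + 1) 0 0 (1 + 1) =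
          (1 : Matrix (Fin (2 ^ k) ⊕ Fin (2 ^ k)) (Fin (2 ^ k) ⊕ Fin (2 ^ k)) ℝ) := by
        rw [← two_smul ℝ (1 : Matrix (Fin (2 ^ k)) (Fin (2 ^ k)) ℝ), fromBlocks_smul, smul_smul,
          smul_zero]
        norm_num [fromBlocks_one]
      rw [this, submatrix_one_equiv]

/-! ### The block matrix -/

/-- The block diagonal matrix with blocks `s • D` and `t • 1`. -/
def blockMatrix {m : ℕ} (r : ℕ) (s t : ℝ) (D : Matrix (Fin m) (Fin m) ℝ) :
    Matrix (Fin (m + r)) (Fin (m + r)) ℝ :=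
  Matrix.reindex finSumFinEquiv finSumFinEquiv (fromBlocks (s • D) 0 0 (t • 1))

lemma blockMatrix_castAdd_castAdd {m : ℕ} (r : ℕ) (s t : ℝ) (D : Matrix (Fin m) (Fin m) ℝ)
    (i j : Fin m) : blockMatrix r s t D (Fin.castAdd r i) (Fin.castAdd r j) = s * D i j := by
  simp [blockMatrix]

lemma blockMatrix_sub {m : ℕ} (r : ℕ) (s t s' t' : ℝ) (D : Matrix (Fin m) (Fin m) ℝ) :
    blockMatrix r s t D - blockMatrix r s' t' D = blockMatrix r (s - s') (t - t') D := by
  ext i j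
  induction i using Fin.addCases <;> induction j using Fin.addCases <;>
    simp [blockMatrix, sub_mul]

lemma blockMatrix_gram {m : ℕ} (r : ℕ) (s t : ℝ) {D : Matrix (Fin m) (Fin m) ℝ}
    (hD : Dᵀ * D = 1) :
    (blockMatrix r s t D)ᵀ * blockMatrix r s t D =
      diagonal fun i => (Fin.append (fun _ : Fin m => s) (fun _ : Fin r => t) i) ^ 2 := by
  rw [blockMatrix, transpose_reindex, reindex_apply, reindex_apply, submatrix_mul_equiv,
    fromBlocks_transpose, fromBlocks_multiply]
  ext i j
  induction i using Fin.addCases with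
  | left i =>
    induction j using Fin.addCases with
    | left j => simp [hD, diagonal_apply, one_apply, pow_two, smul_smul]
    | right j =>
      have h : Fin.castAdd r i ≠ Fin.natAdd m j := fun h => by
        have := congrArg Fin.val h
        simp at this
        omega
      simp [diagonal_apply_ne _ h]
  | right i =>
    induction j using Fin.addCases with
    | left j =>
      have h : Fin.natAdd m i ≠ Fin.castAdd r j := fun h => by
        have := congrArg Fin.val h
        simp at this
        omega
      simp [diagonal_apply_ne _ h]
    | right j => simp [diagonal_apply, one_apply, pow_two]

lemma nnz_le_of_offDiag_eq_zero {n : ℕ} {M : Matrix (Fin n) (Fin n) ℝ}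
    (hM : ∀ i j, i ≠ j → M i j = 0) : nnz M ≤ n := by
  have h : (Finset.univ.filter fun ij : Fin n × Fin n => M ij.1 ij.2 ≠ 0) ⊆
      Finset.univ.image fun i : Fin n => (i, i) := by
    rintro ⟨i, j⟩ hij
    have hne : M i j ≠ 0 := by simpa using hij
    have : i = j := by
      by_contra hne'
      exact hne (hM i j hne')
    simp [this]
  exact (Finset.card_le_card h).trans (Finset.card_image_le.trans (by simp))

lemma nnz_blockMatrix_le {m : ℕ} (r : ℕ) (s t : ℝ) {D : Matrix (Fin m) (Fin m) ℝ}
    (h : ∀ i j, i ≠ j → s * D i j = 0) : nnz (blockMatrix r s t D) ≤ m + r := by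
  refine nnz_le_of_offDiag_eq_zero fun i j hij => ?_
  induction i using Fin.addCases <;> induction j using Fin.addCases
  · rw [blockMatrix_castAdd_castAdd]
    exact h _ _ fun h' => hij (congrArg _ h')
  all_goals simp_all [blockMatrix, one_apply]

/-- The identity block contributes at most as much as the block `s • D` to the Schatten `q`-norm.
For `q = ∞` the exponent reads `1 / 0 = 0`, which is the correct value. -/
lemma schattenNorm_blockMatrix_le {m r : ℕ} {s : ℝ} {q : ℝ≥0∞} (hq : 2 ≤ q) (hs : 1 ≤ s)
    (hr : (r : ℝ) ≤ m * s ^ 2) {D : Matrix (Fin m) (Fin m) ℝ} (hD : Dᵀ * D = 1) :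
    schattenNorm q (blockMatrix r s 1 D) ≤ √2 * s * (m : ℝ) ^ (1 / q.toReal) := by
  have hs0 : 0 ≤ s := by linarith
  have he : ∀ i, 0 ≤ Fin.append (fun _ : Fin m => s) (fun _ : Fin r => (1 : ℝ)) i := fun i => by
    induction i using Fin.addCases <;> simp [hs0]
  have hg := blockMatrix_gram r s 1 hD
  have hsqrt : 1 ≤ √2 := Real.one_le_sqrt.2 (by norm_num)
  by_cases hqt : q = ∞
  · subst hqt
    refine (schattenNorm_top_le_of_gram he hg hs0 fun i => ?_).trans ?_
    · induction i using Fin.addCases <;> simp [hs]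
    · simpa using le_mul_of_one_le_left hs0 hsqrt
  · have hq0 : q ≠ 0 := by rintro rfl; simp at hq
    have hq2 : 2 ≤ q.toReal := by
      simpa using ENNReal.toReal_mono hqt hq
    have hqpos : 0 < q.toReal := by linarith
    have hsq : s ^ 2 ≤ s ^ q.toReal := by
      rw [← Real.rpow_natCast]
      exact Real.rpow_le_rpow_of_exponent_le hs (by simpa using hq2)
    have hr' : (r : ℝ) ≤ m * s ^ q.toReal :=
      hr.trans (mul_le_mul_of_nonneg_left hsq (Nat.cast_nonneg _))
    have hsp : 0 ≤ s ^ q.toReal := Real.rpow_nonneg hs0 _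
    rw [schattenNorm_of_gram he hg hq0 hqt, Fin.sum_univ_add]
    simp only [Fin.append_left, Fin.append_right, Real.one_rpow, Finset.sum_const,
      Finset.card_univ, Fintype.card_fin, nsmul_eq_mul, mul_one]
    calc ((m : ℝ) * s ^ q.toReal + r) ^ (1 / q.toReal)
        ≤ (2 * s ^ q.toReal * m) ^ (1 / q.toReal) :=
          Real.rpow_le_rpow (by positivity) (by linarith) (by positivity)
      _ = 2 ^ (1 / q.toReal) * s * (m : ℝ) ^ (1 / q.toReal) := by
          rw [Real.mul_rpow (by positivity) (by positivity),
            Real.mul_rpow (by positivity) (by positivity), ← Real.rpow_mul hs0,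
            mul_one_div_cancel hqpos.ne', Real.rpow_one]
      _ ≤ √2 * s * (m : ℝ) ^ (1 / q.toReal) := by
          rw [Real.sqrt_eq_rpow]
          gcongr
          norm_num

/-- A good Schatten approximation of the block matrix is non-zero on most of the flat block: every
zero costs squared error `s ^ 2 / m` there, while the columns of the block can carry squared error
at most `m * s ^ 2 / 50`. -/
lemma le_nnz_of_isNormApprox {m r : ℕ} {s : ℝ} {q : ℝ≥0∞} (hq : 2 ≤ q) (hm : 0 < m) (hs : 1 ≤ s)
    (hr : (r : ℝ) ≤ m * s ^ 2) {D : Matrix (Fin m) (Fin m) ℝ} (hD : Dᵀ * D = 1)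
    (hflat : ∀ i j, D i j ^ 2 = 1 / (m : ℝ)) {B : Matrix (Fin (m + r)) (Fin (m + r)) ℝ}
    (hB : IsNormApprox (1 / 10) q (blockMatrix r s 1 D) B) :
    49 / 50 * (m : ℝ) ^ 2 ≤ nnz B := by
  set A := blockMatrix r s 1 D with hA
  have hs0 : 0 < s := by linarith
  have hm0 : (0 : ℝ) < m := by exact_mod_cast hm
  have hC : schattenNorm q (A - B) ≤ 1 / 10 * (√2 * s * (m : ℝ) ^ (1 / q.toReal)) :=
    hB.trans (mul_le_mul_of_nonneg_left (schattenNorm_blockMatrix_le hq hs hr hD) (by norm_num))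
  set S : Finset (Fin (m + r)) := Finset.univ.map (Fin.castAddEmb r) with hSdef
  have hScard : S.card = m := by simp [hSdef]
  have hmass : ∑ j ∈ S, ∑ k, (A - B) k j ^ 2 ≤ m * s ^ 2 / 50 := by
    refine (sum_sq_cols_le hq (A - B) S).trans ?_
    rw [hScard]
    calc (m : ℝ) ^ (1 - 2 / q.toReal) * schattenNorm q (A - B) ^ 2
        ≤ (m : ℝ) ^ (1 - 2 / q.toReal) *
            (1 / 10 * (√2 * s * (m : ℝ) ^ (1 / q.toReal))) ^ 2 := by
          gcongr
          exact schattenNorm_nonneg _ _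
      _ = ((m : ℝ) ^ (1 - 2 / q.toReal) * ((m : ℝ) ^ (1 / q.toReal)) ^ 2) *
            (√2 ^ 2 * s ^ 2 / 100) := by ring
      _ = m * s ^ 2 / 50 := by
          rw [← Real.rpow_mul_natCast hm0.le, ← Real.rpow_add hm0, Real.sq_sqrt (by norm_num)]
          have : 1 - 2 / q.toReal + 1 / q.toReal * ((2 : ℕ) : ℝ) = 1 := by push_cast; ring
          rw [this, Real.rpow_one]
          ring
  set Z : Finset (Fin m × Fin m) := Finset.univ.filter fun ij =>
    B (Fin.castAdd r ij.1) (Fin.castAdd r ij.2) = 0 with hZ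
  have hZmass : (Z.card : ℝ) * (s ^ 2 / m) ≤ ∑ j ∈ S, ∑ k, (A - B) k j ^ 2 := by
    calc (Z.card : ℝ) * (s ^ 2 / m)
        = ∑ ij ∈ Z, (A - B) (Fin.castAdd r ij.1) (Fin.castAdd r ij.2) ^ 2 := by
          rw [← nsmul_eq_mul, ← Finset.sum_const]
          refine Finset.sum_congr rfl fun ij hij => ?_
          rw [Matrix.sub_apply, (Finset.mem_filter.1 hij).2, hA, blockMatrix_castAdd_castAdd, sub_zero,
            mul_pow, hflat, mul_one_div]
      _ ≤ ∑ ij : Fin m × Fin m, (A - B) (Fin.castAdd r ij.1) (Fin.castAdd r ij.2) ^ 2 :=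
          Finset.sum_le_sum_of_subset_of_nonneg (Finset.subset_univ _) fun _ _ _ => sq_nonneg _
      _ = ∑ j : Fin m, ∑ i : Fin m, (A - B) (Fin.castAdd r i) (Fin.castAdd r j) ^ 2 :=
          Fintype.sum_prod_type_right _
      _ ≤ ∑ j : Fin m, ∑ k, (A - B) k (Fin.castAdd r j) ^ 2 := by
          refine Finset.sum_le_sum fun j _ => ?_
          rw [Fin.sum_univ_add]
          exact le_add_of_nonneg_right (Finset.sum_nonneg fun _ _ => sq_nonneg _)
      _ = _ := by rw [hSdef, Finset.sum_map]; rfl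
  have hZcard : (Z.card : ℝ) ≤ (m : ℝ) ^ 2 / 50 := by
    have h := hZmass.trans hmass
    have h' : (Z.card : ℝ) * (s ^ 2 / m) ≤ (m : ℝ) ^ 2 / 50 * (s ^ 2 / m) := by
      refine h.trans (le_of_eq ?_)
      field_simp
    exact le_of_mul_le_mul_right h' (by positivity)
  have hcount : m ^ 2 ≤ Z.card + nnz B := by
    have hcompl : Z.card + Zᶜ.card = m ^ 2 := by
      rw [Finset.card_add_card_compl]
      simp [sq]
    have hle : Zᶜ.card ≤ nnz B := by
      refine Finset.card_le_card_of_injOn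
        (fun ij => (Fin.castAdd r ij.1, Fin.castAdd r ij.2)) (fun ij hij => ?_) ?_
      · simpa [hZ] using hij
      · rintro ⟨a, b⟩ - ⟨a', b'⟩ - h
        simpa using h
    omega
  have hcount' : (m : ℝ) ^ 2 ≤ Z.card + nnz B := by exact_mod_cast hcount
  linarith

/-- Dropping the flat block is a good Schatten `p`-approximation if `m * s ≤ r / L` with
`1 / L ≤ ε`. Since `s ≥ 1` and `L ≥ 1`, all exponents `p < 1` reduce to this condition. -/
lemma isNormApprox_blockMatrix {m r : ℕ} {s L ε : ℝ} {p : ℝ≥0} (hp : p < 1) (hs : 1 ≤ s)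
    (hL : 1 ≤ L) (hε : 1 / L ≤ ε) (h : m * s ≤ r / L) {D : Matrix (Fin m) (Fin m) ℝ}
    (hD : Dᵀ * D = 1) :
    IsNormApprox ε (p : ℝ≥0∞) (blockMatrix r s 1 D) (blockMatrix r 0 1 D) := by
  have hs0 : 0 < s := by linarith
  have hL0 : 0 < L := by linarith
  have hε0 : 0 < ε := lt_of_lt_of_le (by positivity) hε
  have hrL : (r : ℝ) / L ≤ ε * r := by
    rw [div_eq_mul_one_div, mul_comm]
    exact mul_le_mul_of_nonneg_right hε (Nat.cast_nonneg _)
  have hgA := blockMatrix_gram r s 1 hD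
  have hgC := blockMatrix_gram r s 0 hD
  rw [IsNormApprox, blockMatrix_sub, sub_zero, sub_self]
  by_cases hp0 : p = 0
  · subst hp0
    rw [ENNReal.coe_zero, schattenNorm_zero_exponent_of_gram hgA,
      schattenNorm_zero_exponent_of_gram hgC, Fin.sum_univ_add, Fin.sum_univ_add]
    simp only [Fin.append_left, Fin.append_right, hs0.ne', one_ne_zero, if_true, if_false,
      Finset.sum_const, Finset.card_univ, Fintype.card_fin, nsmul_eq_mul, mul_one, mul_zero,
      add_zero]
    have h1 : (m : ℝ) ≤ m * s := le_mul_of_one_le_right (Nat.cast_nonneg _) hs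
    have h2 : (0 : ℝ) ≤ ε * m := by positivity
    linarith
  · have hpR : 0 < (p : ℝ) := by exact_mod_cast pos_iff_ne_zero.2 hp0
    have hp1 : (p : ℝ) ≤ 1 := by exact_mod_cast hp.le
    have hpE : (p : ℝ≥0∞) ≠ 0 := by simpa using hp0
    rw [schattenNorm_of_gram (fun i => ?_) hgA hpE ENNReal.coe_ne_top,
      schattenNorm_of_gram (fun i => ?_) hgC hpE ENNReal.coe_ne_top, Fin.sum_univ_add,
      Fin.sum_univ_add]
    rotate_left
    · induction i using Fin.addCases <;> simp [hs0.le]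
    · induction i using Fin.addCases <;> simp [hs0.le]
    simp only [Fin.append_left, Fin.append_right, ENNReal.coe_toReal, Real.one_rpow,
      Real.zero_rpow hpR.ne', Finset.sum_const, Finset.card_univ, Fintype.card_fin, nsmul_eq_mul,
      mul_one, mul_zero, add_zero]
    have hsp : s ^ (p : ℝ) ≤ s := by
      simpa using Real.rpow_le_rpow_of_exponent_le hs hp1
    have hLp : 1 / L ≤ ε ^ (p : ℝ) := by
      refine le_trans ?_ (Real.rpow_le_rpow (by positivity) hε hpR.le)
      simpa using Real.rpow_le_rpow_of_exponent_ge (by positivity : 0 < 1 / L)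
        ((div_le_one hL0).2 hL) hp1
    have hkey : (m : ℝ) * s ^ (p : ℝ) ≤ ε ^ (p : ℝ) * (m * s ^ (p : ℝ) + r) := by
      have h1 : (m : ℝ) * s ^ (p : ℝ) ≤ m * s :=
        mul_le_mul_of_nonneg_left hsp (Nat.cast_nonneg _)
      have h2 : (r : ℝ) / L ≤ ε ^ (p : ℝ) * r := by
        rw [div_eq_mul_one_div, mul_comm]
        exact mul_le_mul_of_nonneg_right hLp (Nat.cast_nonneg _)
      have h3 : 0 ≤ ε ^ (p : ℝ) * (m * s ^ (p : ℝ)) := by positivity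
      linarith
    calc ((m : ℝ) * s ^ (p : ℝ)) ^ (1 / (p : ℝ))
        ≤ (ε ^ (p : ℝ) * (m * s ^ (p : ℝ) + r)) ^ (1 / (p : ℝ)) :=
          Real.rpow_le_rpow (by positivity) hkey (by positivity)
      _ = ε * (m * s ^ (p : ℝ) + r) ^ (1 / (p : ℝ)) := by
          rw [Real.mul_rpow (by positivity) (by positivity), ← Real.rpow_mul hε0.le,
            mul_one_div_cancel hpR.ne', Real.rpow_one]

/-- The size of the flat block: a power of two of order `n / L ^ 2`, but at least `1`. -/
lemma exists_block_exponent {n : ℕ} {L : ℝ} (hL : 1 ≤ L) :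
    ∃ k : ℕ, (n : ℝ) ≤ 8 * L ^ 2 * 2 ^ k ∧ (k = 0 ∨ 4 * L ^ 2 * 2 ^ k ≤ n) := by
  have hL2 : 0 < 4 * L ^ 2 := by positivity
  rcases lt_or_ge (n : ℝ) (4 * L ^ 2) with h | h
  · exact ⟨0, by rw [pow_zero, mul_one]; linarith, Or.inl rfl⟩
  · obtain ⟨k, hk1, hk2⟩ := exists_nat_pow_near ((one_le_div hL2).2 h) one_lt_two
    rw [le_div_iff₀ hL2] at hk1
    rw [div_lt_iff₀ hL2, pow_succ] at hk2
    exact ⟨k, by linarith, Or.inr (by linarith)⟩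

end SchattenSparse

/-! ### The gap between the exponents `p` and `q` -/

open SchattenSparse

theorem mainTheorem3 (p : ℝ≥0) (hp : p < 1) (q : ℝ≥0∞) (hq : 2 ≤ q) :
    ∃ c : ℝ, 0 < c ∧ ∃ k : ℕ, ∀ n : ℕ, 2 ≤ n → ∀ ε : ℝ,
      1 / Real.logb 2 n < ε →
      (p ≠ 0 → ε < ((2 : ℝ) ^ (p : ℝ) - 1) ^ (1 / (p : ℝ))) →
      ∃ A : Matrix (Fin n) (Fin n) ℝ,
        (∃ A' : Matrix (Fin n) (Fin n) ℝ, SchattenSparse.IsNormSparsifier ε (p : ℝ≥0∞) n A A') ∧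
        ∀ B : Matrix (Fin n) (Fin n) ℝ, SchattenSparse.IsNormApprox (1 / 10) q A B →
          c * (n : ℝ) ^ 2 / Real.logb 2 n ^ k ≤ (SchattenSparse.nnz B : ℝ) := by
  -- The bounds `49 / 50 * m ^ 2 ≤ nnz B` and `n ≤ 8 * L ^ 2 * m` give the exponent `4` and any
  -- constant up to `49 / 3200`.
  refine ⟨1 / 100, by norm_num, 4, fun n hn ε hε _ => ?_⟩
  have hn0 : (0 : ℝ) < n := by positivity
  set L := Real.logb 2 n with hLdef
  have hL : 1 ≤ L := by
    rw [hLdef, Real.le_logb_iff_rpow_le one_lt_two hn0, Real.rpow_one]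
    exact_mod_cast hn
  have hL0 : 0 < L := by linarith
  have hL4 : 1 ≤ 4 * L ^ 2 := by nlinarith
  have hε0 : 0 ≤ ε := le_trans (by positivity) hε.le
  obtain ⟨k, hnk, hk⟩ := exists_block_exponent (n := n) hL
  obtain ⟨D, hflat, hD⟩ := exists_flat_orthogonal k
  have hm0 : (0 : ℝ) < 2 ^ k := by positivity
  have hmn : 2 ^ k ≤ n := by
    rcases hk with rfl | hk
    · simp; omega
    · have : (2 : ℝ) ^ k ≤ n := by
        exact (le_mul_of_one_le_left hm0.le hL4).trans hk
      exact_mod_cast this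
  obtain ⟨r, hr⟩ := Nat.exists_eq_add_of_le hmn
  have hnr : (n : ℝ) = 2 ^ k + r := by rw [hr]; push_cast; ring
  -- The choice `s ^ 2 = n / m` gives `r ≤ m * s ^ 2`, so the flat block dominates from `q = 2` on.
  set s := √((n : ℝ) / 2 ^ k) with hs
  have hss : s ^ 2 = n / 2 ^ k := Real.sq_sqrt (by positivity)
  have hms : 2 ^ k * s ^ 2 = n := by rw [hss]; field_simp
  have hs1 : 1 ≤ s := by
    rw [hs, Real.one_le_sqrt, one_le_div hm0]
    exact_mod_cast hmn
  clear_value L s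
  subst hr
  refine ⟨blockMatrix r s 1 D, ?_, fun B hB => ?_⟩
  · rcases hk with rfl | hk
    · -- A `1 × 1` flat block: the matrix is diagonal and is its own sparsifier.
      refine ⟨blockMatrix r s 1 D, ?_, nnz_blockMatrix_le r s 1 fun i j hij => ?_⟩
      · rw [IsNormApprox, sub_self, schattenNorm_zero]
        exact mul_nonneg hε0 (schattenNorm_nonneg _ _)
      · exact absurd (Subsingleton.elim (α := Fin 1) i j) hij
    · refine ⟨blockMatrix r 0 1 D, isNormApprox_blockMatrix hp hs1 hL hε.le ?_ hD,
        nnz_blockMatrix_le r 0 1 fun i j _ => zero_mul _⟩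
      -- `m * s = √(n * m) ≤ n / (2 * L) ≤ r / L`.
      have hsL : 2 * L ≤ s := by
        refine le_of_sq_le_sq ?_ (by linarith)
        rw [hss, le_div_iff₀ hm0]
        linarith
      rw [le_div_iff₀ hL0]
      push_cast
      have h1 : (2 : ℝ) ^ k * s * (2 * L) ≤ 2 ^ k * s * s := by gcongr
      have h2 : 2 * (2 : ℝ) ^ k ≤ 2 ^ k + r := by
        rw [← hnr]
        refine le_trans (mul_le_mul_of_nonneg_right ?_ hm0.le) hk
        nlinarith
      nlinarith
  · have h := le_nnz_of_isNormApprox hq (by positivity) hs1 (by push_cast; rw [hms]; linarith) hD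
      (by simpa using hflat) hB
    refine le_trans ?_ h
    push_cast at hnk h ⊢
    rw [div_le_iff₀ (by positivity)]
    have h2 : ((2 : ℝ) ^ k + r) ^ 2 ≤ (8 * L ^ 2 * 2 ^ k) ^ 2 := by gcongr
    have h3 : 0 ≤ ((2 : ℝ) ^ k) ^ 2 * L ^ 4 := by positivity
    nlinarith
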